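/- A coframe is a poset whose opposite is a frame; coframe morphisms preserve arbitrary infima and finite suprema. A topological coframe is a coframe $L$ together with a sublattice $C(L)$ (closed under finite infima and finite suprema, including the empty ones) of complemented elements of $L$, called its closed elements; morphisms of topological coframes are the coframe morphisms that map closed elements to closed elements. A topological coframe $L$ is strong if $C(L)$ is closed under arbitrary infima taken in $L$; strong topological coframes form a full subcategory. Let $\bigwedge C(L)$ be the set of all infima in $L$ of families of closed elements; it is a subcoframe of $L$, and $L \mapsto (\bigwedge C(L))^{op}$, acting on morphisms by restriction, is a functor $\bigwedge C^{op}$ from (strong) topological coframes to frames. For a frame $\Omega$, let $S\ell(\Omega)$ be the coframe of sublocales of $\Omega$ ordered by inclusion, whose closed elements are the closed sublocales $\mathfrak{c}(u) = {\uparrow} u$, $u \in \Omega$; it is a strong topological coframe. For a frame morphism $\varphi \colon \Omega \to \Omega'$, let $S\ell(\varphi) \colon S\ell(\Omega) \to S\ell(\Omega')$ be localic preimage: $S\ell(\varphi)(S)$ is the largest sublocale of $\Omega'$ that the right adjoint of $\varphi$ maps into $S$. This makes $S\ell$ a functor from frames to strong topological coframes. Then: 1. For every frame morphism $\varphi \colon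 \Omega \to \Omega'$, $S\ell(\varphi)$ is the unique coframe morphism $S\ell(\Omega) \to S\ell(\Omega')$ that maps $\mathfrak{c}(u)$ to $\mathfrak{c}(\varphi(u))$ for every $u \in \Omega$. 2. There is a coreflection $S\ell \dashv \bigwedge C^{op}$ between the category of frames and the category of strong topological coframes: $S\ell$ is full and faithful and left adjoint to $\bigwedge C^{op}$, for an adjunction whose unit is the isomorphism $\Omega \to \bigwedge C^{op}(S\ell(\Omega))$, $u \mapsto \mathfrak{c}(u)$, and whose counit $S\ell(\bigwedge C^{op}(L)) \to L$ maps $\mathfrak{c}(c)$ to $c$ for every $c \in \bigwedge C(L)$ (which equals $C(L)$, as $L$ is strong). 3. Consequently, the category of locales (the opposite of the category of frames) is, through $S\ell$, a reflective subcategory of the opposite of the category of strong topological coframes, with reflector $\bigwedge C^{op}$. -/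

import Mathlib

open CategoryTheory

universe u

/-- A morphism of coframes: a map that preserves arbitrary infima (hence `⊤`) and finite suprema. -/
structure CoframeHom (α β : Type*) [CompleteLattice α] [CompleteLattice β] extends
    sInfHom α β where
  map_sup' : ∀ a b, toFun (a ⊔ b) = toFun a ⊔ toFun b
  map_bot' : toFun ⊥ = ⊥

namespace CoframeHom

instance instFunLike (α β : Type*) [CompleteLattice α] [CompleteLattice β] :
    FunLike (CoframeHom α β) α β where
  coe φ := φ.toFun
  coe_injective := by
    rintro ⟨⟨f, _⟩, _, _⟩ ⟨⟨g, _⟩, _, _⟩ h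
    cases h
    rfl

variable {α β γ : Type*} [CompleteLattice α] [CompleteLattice β] [CompleteLattice γ]

theorem ext {φ ψ : CoframeHom α β} (h : ∀ a, φ a = ψ a) : φ = ψ := DFunLike.ext _ _ h

theorem apply_sInf (φ : CoframeHom α β) (s : Set α) : φ (sInf s) = sInf (φ '' s) :=
  φ.map_sInf' s

theorem apply_sup (φ : CoframeHom α β) (a b : α) : φ (a ⊔ b) = φ a ⊔ φ b := φ.map_sup' a b

theorem apply_bot (φ : CoframeHom α β) : φ ⊥ = ⊥ := φ.map_bot'

/-- The identity morphism. -/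
def id (α : Type*) [CompleteLattice α] : CoframeHom α α where
  toFun a := a
  map_sInf' s := by simp
  map_sup' _ _ := rfl
  map_bot' := rfl

/-- Composition, in diagrammatic order. -/
def comp (φ : CoframeHom α β) (ψ : CoframeHom β γ) : CoframeHom α γ where
  toFun a := ψ (φ a)
  map_sInf' s := by rw [φ.apply_sInf, ψ.apply_sInf, Set.image_image]
  map_sup' a b := by rw [φ.apply_sup, ψ.apply_sup]
  map_bot' := by rw [φ.apply_bot, ψ.apply_bot]

end CoframeHom

/-- A topological coframe: a coframe `L` with a sublattice `C(L)` (closed under all finite infima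
and finite suprema, including the empty ones) of complemented elements, its closed elements. -/
structure TopCoFrm where
  /-- The underlying coframe `L`. -/
  carrier : Type u
  [str : Order.Coframe carrier]
  /-- The set `C(L)` of closed elements. -/
  closed : Set carrier
  bot_mem : ⊥ ∈ closed
  top_mem : ⊤ ∈ closed
  sup_mem : ∀ a ∈ closed, ∀ b ∈ closed, a ⊔ b ∈ closed
  inf_mem : ∀ a ∈ closed, ∀ b ∈ closed, a ⊓ b ∈ closed
  isComplemented : ∀ a ∈ closed, IsComplemented a

namespace TopCoFrm

instance instCoeSort : CoeSort TopCoFrm.{u} (Type u) := ⟨TopCoFrm.carrier⟩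

instance instCoframe (L : TopCoFrm.{u}) : Order.Coframe L := L.str

/-- Morphisms of topological coframes: continuous coframe morphisms, that is, those which map
closed elements to closed elements. -/
structure Hom (L L' : TopCoFrm.{u}) where
  /-- The underlying coframe morphism. -/
  toCoframeHom : CoframeHom L L'
  map_closed : ∀ c ∈ L.closed, toCoframeHom c ∈ L'.closed

/-- The category of topological coframes. -/
instance instCategory : Category TopCoFrm.{u} where
  Hom L L' := Hom L L'
  id L := ⟨CoframeHom.id L, fun _ h => h⟩
  comp φ ψ := ⟨φ.toCoframeHom.comp ψ.toCoframeHom,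
    fun c hc => ψ.map_closed _ (φ.map_closed c hc)⟩

theorem Hom.ext {L L' : TopCoFrm.{u}} {φ ψ : L ⟶ L'}
    (h : Hom.toCoframeHom φ = Hom.toCoframeHom ψ) : φ = ψ := by
  obtain ⟨_, _⟩ := φ
  obtain ⟨_, _⟩ := ψ
  cases h
  rfl

/-- The coframe morphism underlying a morphism of topological coframes. -/
def Hom.hom {L L' : TopCoFrm.{u}} (φ : L ⟶ L') : CoframeHom L L' := Hom.toCoframeHom φ

/-- A topological coframe `L` is strong if `C(L)` is closed under all infima taken in `L`. -/
def isStrong : ObjectProperty TopCoFrm.{u} := fun L =>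
  ∀ s : Set L, s ⊆ L.closed → sInf s ∈ L.closed

/-- The set `⋀ C(L)` of all infima, taken in `L`, of families of closed elements. -/
def infClosed (L : TopCoFrm.{u}) : Set L := {x | ∃ s ⊆ L.closed, sInf s = x}

section InfClosed

variable (L : TopCoFrm.{u})

theorem sInf_mem_infClosed (t : Set L) (ht : t ⊆ L.infClosed) : sInf t ∈ L.infClosed := by
  refine ⟨{c | c ∈ L.closed ∧ ∃ x ∈ t, x ≤ c}, fun c hc => hc.1, le_antisymm ?_ ?_⟩
  · refine le_sInf fun x hx => ?_
    obtain ⟨s, hs, rfl⟩ := ht hx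
    exact le_sInf fun c hc => sInf_le ⟨hs hc, _, hx, sInf_le hc⟩
  · refine le_sInf ?_
    rintro c ⟨_, x, hx, hxc⟩
    exact (sInf_le hx).trans hxc

theorem sup_mem_infClosed {a b : L} (ha : a ∈ L.infClosed) (hb : b ∈ L.infClosed) :
    a ⊔ b ∈ L.infClosed := by
  obtain ⟨s, hs, rfl⟩ := ha
  obtain ⟨t, ht, rfl⟩ := hb
  refine ⟨(fun p : L × L => p.1 ⊔ p.2) '' (s ×ˢ t), ?_, ?_⟩
  · rintro _ ⟨⟨x, y⟩, ⟨hx, hy⟩, rfl⟩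
    exact L.sup_mem x (hs hx) y (ht hy)
  · rw [sInf_sup_sInf, sInf_image]

theorem bot_mem_infClosed : (⊥ : L) ∈ L.infClosed :=
  ⟨{⊥}, by simpa using L.bot_mem, by simp⟩

/-- The infima in `⋀ C(L)` are those of `L`. -/
instance instInfSetInfClosed : InfSet L.infClosed :=
  ⟨fun t => ⟨sInf (Subtype.val '' t), L.sInf_mem_infClosed _ (by rintro _ ⟨x, _, rfl⟩; exact x.2)⟩⟩

theorem isGLB_sInf_infClosed (t : Set L.infClosed) : IsGLB t (sInf t) :=
  ⟨fun x hx => sInf_le (Set.mem_image_of_mem Subtype.val hx),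
    fun x hx => le_sInf (a := x.1) (by rintro _ ⟨y, hy, rfl⟩; exact hx hy)⟩

/-- `⋀ C(L)` is a complete lattice; its arbitrary infima and its finite suprema are those
of `L`. -/
instance instCompleteLatticeInfClosed : CompleteLattice L.infClosed where
  __ := completeLatticeOfInf L.infClosed L.isGLB_sInf_infClosed
  sup a b := ⟨a.1 ⊔ b.1, L.sup_mem_infClosed a.2 b.2⟩
  le_sup_left a b := le_sup_left (a := a.1) (b := b.1)
  le_sup_right a b := le_sup_right (a := a.1) (b := b.1)
  sup_le a b c hac hbc := sup_le (a := a.1) (b := b.1) (c := c.1) hac hbc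
  bot := ⟨⊥, L.bot_mem_infClosed⟩
  bot_le a := bot_le (a := a.1)

theorem coe_sInf_infClosed (t : Set L.infClosed) :
    ((sInf t : L.infClosed) : L) = sInf (Subtype.val '' t) := rfl

/-- `⋀ C(L)` is a coframe. -/
instance instCoframeInfClosed : Order.Coframe L.infClosed :=
  .ofMinimalAxioms {
    iInf_sup_le_sup_sInf := fun a s => by
      rw [← Subtype.coe_le_coe]
      change _ ≤ a.1 ⊔ ((sInf s : L.infClosed) : L)
      rw [coe_sInf_infClosed, sup_sInf_eq]
      refine le_iInf₂ ?_
      rintro _ ⟨b, hb, rfl⟩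
      exact (iInf₂_le b hb : (⨅ b ∈ s, a ⊔ b) ≤ a ⊔ b) }

end InfClosed

theorem Hom.map_infClosed {L L' : TopCoFrm.{u}} (φ : L ⟶ L') {x : L} (hx : x ∈ L.infClosed) :
    Hom.hom φ x ∈ L'.infClosed := by
  obtain ⟨s, hs, rfl⟩ := hx
  refine ⟨Hom.hom φ '' s, ?_, (CoframeHom.apply_sInf _ s).symm⟩
  rintro _ ⟨c, hc, rfl⟩
  exact Hom.map_closed φ c (hs hc)

/-- The functor `⋀ C^op` from topological coframes to frames: it maps `L` to the frame
`(⋀ C(L))^op`, and acts on morphisms by restriction. -/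
def infClosedOp : TopCoFrm.{u} ⥤ Frm.{u} where
  obj L := Frm.of (L.infClosed)ᵒᵈ
  map {L L'} φ := Frm.ofHom {
    toFun := fun x => OrderDual.toDual
      ⟨Hom.hom φ (OrderDual.ofDual x).1, Hom.map_infClosed φ (OrderDual.ofDual x).2⟩
    map_inf' := fun x y => Subtype.ext (CoframeHom.apply_sup _ _ _)
    map_top' := Subtype.ext (CoframeHom.apply_bot _)
    map_sSup' := fun s => Subtype.ext (by
      change Hom.hom φ (sInf (Subtype.val '' (OrderDual.toDual ⁻¹' s))) =
        sInf (Subtype.val '' (OrderDual.toDual ⁻¹' ((fun x : (L.infClosed)ᵒᵈ => OrderDual.toDual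
          (⟨Hom.hom φ (OrderDual.ofDual x).1, Hom.map_infClosed φ (OrderDual.ofDual x).2⟩ :
            L'.infClosed)) '' s)))
      rw [CoframeHom.apply_sInf]
      congr 1
      ext y
      constructor
      · rintro ⟨_, ⟨x, hx, rfl⟩, rfl⟩
        exact ⟨_, ⟨OrderDual.toDual x, hx, rfl⟩, rfl⟩
      · rintro ⟨_, ⟨x, hx, rfl⟩, rfl⟩
        exact ⟨_, ⟨OrderDual.ofDual x, hx, rfl⟩, rfl⟩) }

end TopCoFrm

/-- The category of strong topological coframes, a full subcategory of topological coframes. -/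
abbrev StrongTopCoFrm : Type (u + 1) := TopCoFrm.isStrong.{u}.FullSubcategory

namespace Sublocale

section Objects

variable {X : Type*} [Order.Frame X]

/-- The closed sublocale `𝔠(u) = ↑u`. -/
def closedSub (u : X) : Sublocale X where
  carrier := Set.Ici u
  sInf_mem' _ hs := le_sInf fun _ hx => hs hx
  himp_mem' _ _ hb := le_trans hb le_himp

/-- The open sublocale `𝔬(u) = {u ⇨ v | v}`. -/
def openSub (u : X) : Sublocale X where
  carrier := Set.range fun v => u ⇨ v
  sInf_mem' s hs := by
    refine ⟨sInf s, le_antisymm (le_sInf fun x hx => ?_) le_himp⟩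
    obtain ⟨v, rfl⟩ := hs hx
    calc u ⇨ sInf s ≤ u ⇨ (u ⇨ v) := himp_le_himp_left (sInf_le hx)
      _ = u ⇨ v := himp_idem
  himp_mem' := by
    rintro a _ ⟨v, rfl⟩
    exact ⟨a ⇨ v, himp_left_comm u a v⟩

theorem mem_closedSub {u x : X} : x ∈ closedSub u ↔ u ≤ x := Iff.rfl

theorem mem_openSub {u x : X} : x ∈ openSub u ↔ ∃ v, u ⇨ v = x := Iff.rfl

theorem mem_bot_iff {x : X} : x ∈ (⊥ : Sublocale X) ↔ x = ⊤ := by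
  let T : Sublocale X :=
    { carrier := {⊤}
      sInf_mem' := fun s hs => by
        rw [Set.mem_singleton_iff, sInf_eq_top]
        exact fun a ha => hs ha
      himp_mem' := fun a b hb => by
        rw [Set.mem_singleton_iff] at hb ⊢
        rw [hb, himp_top] }
  constructor
  · intro hx
    exact (bot_le : ⊥ ≤ T) hx
  · rintro rfl
    exact top_mem

/-- The sublocale whose sub-sublocales are described in `le_closedSub_sup_openSub`. -/
def condSub (u v : X) : Sublocale X where
  carrier := {s | ∀ a, v ≤ a ⇨ s → u ≤ a ⇨ s}
  sInf_mem' t ht a h := by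
    rw [le_himp_iff] at h ⊢
    exact le_sInf fun x hx => le_himp_iff.1 (ht hx a (le_himp_iff.2 (h.trans (sInf_le hx))))
  himp_mem' a b hb c h := by
    rw [himp_himp] at h ⊢
    exact hb _ h

theorem le_closedSub_sup_openSub {S : Sublocale X} {u v : X} :
    S ≤ closedSub u ⊔ openSub v ↔ ∀ s ∈ S, v ≤ s → u ≤ s := by
  constructor
  · intro h s hs hv
    have h1 : closedSub u ≤ condSub u v := fun x hx a _ => le_trans hx le_himp
    have h2 : openSub v ≤ condSub u v := by
      rintro _ ⟨t, rfl⟩ a ha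
      have h3 : a ⇨ (v ⇨ t) = ⊤ := by
        rw [himp_left_comm] at ha ⊢
        rw [le_himp_iff, inf_idem] at ha
        exact himp_eq_top_iff.2 ha
      exact h3 ▸ le_top
    have h4 : ∀ a, v ≤ a ⇨ s → u ≤ a ⇨ s := (h.trans (sup_le h1 h2)) hs
    simpa using h4 ⊤ (by simpa using hv)
  · intro h s hs
    have key : (u ⊔ s) ⊓ (v ⇨ s) = s := by
      refine le_antisymm ?_ (le_inf le_sup_right le_himp)
      rw [inf_sup_right]
      refine sup_le ?_ inf_le_left
      exact le_himp_iff.1 (h _ (himp_mem hs) (le_himp_himp (a := v) (b := s)))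
    rw [← key]
    exact inf_mem ((le_sup_left : closedSub u ≤ _) (mem_closedSub.2 le_sup_left))
      ((le_sup_right : openSub v ≤ closedSub u ⊔ openSub v) ⟨s, rfl⟩)

theorem isCompl_closedSub_openSub (u : X) : IsCompl (closedSub u) (openSub u) := by
  constructor
  · intro T h1 h2 x hx
    have hu : u ≤ x := h1 hx
    obtain ⟨t, rfl⟩ := h2 hx
    rw [mem_bot_iff, himp_eq_top_iff]
    rwa [le_himp_iff, inf_idem] at hu
  · rw [codisjoint_iff_le_sup]
    exact le_closedSub_sup_openSub.2 fun s _ h => h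

theorem openSub_bot : openSub (⊥ : X) = ⊥ :=
  le_bot_iff.1 (by
    rintro _ ⟨v, rfl⟩
    exact mem_bot_iff.2 (bot_himp v))

theorem sInf_image_closedSub (s : Set X) : sInf (closedSub '' s) = closedSub (sSup s) := by
  refine le_antisymm (fun x hx => ?_) (le_sInf ?_)
  · exact sSup_le fun u hu =>
      (sInf_le (Set.mem_image_of_mem closedSub hu) : sInf (closedSub '' s) ≤ closedSub u) hx
  · rintro _ ⟨u, hu, rfl⟩ x hx
    exact (le_sSup hu).trans hx

theorem closedSub_sup (u v : X) : closedSub u ⊔ closedSub v = closedSub (u ⊓ v) := by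
  refine le_antisymm (sup_le (fun x hx => inf_le_left.trans hx) fun x hx => inf_le_right.trans hx)
    fun x hx => ?_
  have : (u ⊔ x) ⊓ (v ⊔ x) = x := by rw [← sup_inf_right, sup_eq_right]; exact hx
  rw [← this]
  exact inf_mem ((le_sup_left : closedSub u ≤ _) (mem_closedSub.2 le_sup_left))
    ((le_sup_right : closedSub v ≤ closedSub u ⊔ closedSub v) (mem_closedSub.2 le_sup_left))

theorem openSub_sup (u v : X) : openSub u ⊔ openSub v = openSub (u ⊔ v) := by
  have h1 := isCompl_closedSub_openSub u
  have h2 := isCompl_closedSub_openSub v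
  have h3 : closedSub u ⊓ closedSub v = closedSub (u ⊔ v) := by
    have := sInf_image_closedSub {u, v}
    rwa [Set.image_pair, sInf_pair, sSup_pair] at this
  have h4 := isCompl_closedSub_openSub (u ⊔ v)
  rw [← h3] at h4
  exact (h1.inf_sup h2).right_unique h4

theorem closedSub_bot : closedSub (⊥ : X) = ⊤ :=
  top_le_iff.1 fun _ _ => mem_closedSub.2 bot_le

theorem closedSub_top : closedSub (⊤ : X) = ⊥ :=
  le_bot_iff.1 fun _ hx => mem_bot_iff.2 (top_le_iff.1 hx)

/-- Every sublocale is an intersection of sublocales of the form `𝔠(u) ⊔ 𝔬(v)`. -/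
theorem eq_sInf (S : Sublocale X) :
    S = sInf {T | ∃ u v, T = closedSub u ⊔ openSub v ∧ S ≤ T} := by
  refine le_antisymm (le_sInf ?_) fun t ht => ?_
  · rintro _ ⟨u, v, rfl, h⟩
    exact h
  · have hmem : sInf {s | s ∈ S ∧ t ≤ s} ∈ S := sInf_mem fun s hs => hs.1
    have hS : S ≤ closedSub (sInf {s | s ∈ S ∧ t ≤ s}) ⊔ openSub t :=
      le_closedSub_sup_openSub.2 fun s hs hts => sInf_le ⟨hs, hts⟩
    have h := le_closedSub_sup_openSub.1 le_rfl t
      ((sInf_le (show _ ∈ {T | ∃ u v, T = closedSub u ⊔ openSub v ∧ S ≤ T} from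
        ⟨_, _, rfl, hS⟩) : _ ≤ _) ht) le_rfl
    rwa [le_antisymm h (le_sInf fun s hs => hs.2)] at hmem

end Objects

section Maps

variable {X Y Z : Type*} [Order.Frame X] [Order.Frame Y] [Order.Frame Z]

/-- The right adjoint `Y → X` of a frame morphism `X → Y` (a localic map). -/
def rightAdj (φ : FrameHom X Y) (y : Y) : X := sSup {x | φ x ≤ y}

theorem gc_rightAdj (φ : FrameHom X Y) : GaloisConnection φ (rightAdj φ) := fun x y => by
  refine ⟨fun h => le_sSup h, fun h => ?_⟩
  calc φ x ≤ φ (sSup {x | φ x ≤ y}) := OrderHomClass.mono φ h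
    _ = sSup (φ '' {x | φ x ≤ y}) := map_sSup φ _
    _ ≤ y := sSup_le (by rintro _ ⟨z, hz, rfl⟩; exact hz)

/-- The localic image of a sublocale. -/
def localicImage (φ : FrameHom X Y) (T : Sublocale Y) : Sublocale X where
  carrier := rightAdj φ '' (T : Set Y)
  sInf_mem' s hs := by
    refine ⟨sInf {t | t ∈ T ∧ rightAdj φ t ∈ s}, sInf_mem fun t ht => ht.1, ?_⟩
    rw [(gc_rightAdj φ).u_sInf]
    refine le_antisymm (le_sInf fun x hx => ?_) (le_iInf₂ fun t ht => sInf_le ht.2)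
    obtain ⟨t, ht, rfl⟩ := hs hx
    exact iInf₂_le t ⟨ht, hx⟩
  himp_mem' := by
    rintro a _ ⟨t, ht, rfl⟩
    refine ⟨φ a ⇨ t, himp_mem ht, eq_of_forall_le_iff fun c => ?_⟩
    rw [← (gc_rightAdj φ).le_iff_le, le_himp_iff, le_himp_iff, ← map_inf,
      (gc_rightAdj φ).le_iff_le]

/-- The localic preimage of a sublocale `S` of `X`: the largest sublocale of `Y` whose elements
are mapped into `S` by the right adjoint of `φ`. -/
def localicPreimage (φ : FrameHom X Y) (S : Sublocale X) : Sublocale Y :=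
  sSup {T | ∀ t ∈ T, rightAdj φ t ∈ S}

theorem localicImage_le_iff {φ : FrameHom X Y} {S : Sublocale X} {T : Sublocale Y} :
    localicImage φ T ≤ S ↔ ∀ t ∈ T, rightAdj φ t ∈ S := by
  constructor
  · exact fun h t ht => h ⟨t, ht, rfl⟩
  · rintro h _ ⟨t, ht, rfl⟩
    exact h t ht

theorem gc_localicImage (φ : FrameHom X Y) :
    GaloisConnection (localicImage φ) (localicPreimage φ) := fun T S => by
  rw [localicImage_le_iff]
  refine ⟨fun h => le_sSup h, fun h => ?_⟩
  have hmono : Monotone (localicImage φ) := by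
    rintro T₁ T₂ h _ ⟨t, ht, rfl⟩
    exact ⟨t, h ht, rfl⟩
  let U : Sublocale Y :=
    { carrier := {y | ∀ b, rightAdj φ (b ⇨ y) ∈ S}
      sInf_mem' := fun s hs b => by
        have hb : b ⇨ sInf s = sInf ((fun y => b ⇨ y) '' s) := by
          refine eq_of_forall_le_iff fun c => ?_
          rw [le_himp_iff, le_sInf_iff, le_sInf_iff, Set.forall_mem_image]
          simp only [le_himp_iff]
        rw [hb, (gc_rightAdj φ).u_sInf]
        refine iInf_mem fun y => iInf_mem fun hy => ?_
        obtain ⟨z, hz, rfl⟩ := hy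
        exact hs hz b
      himp_mem' := fun a y hy b => by
        rw [himp_himp]
        exact hy _ }
  have hU : localicPreimage φ S ≤ U :=
    sSup_le fun V hV y hy b => hV _ (himp_mem hy)
  intro t ht
  have h1 : ∀ b, rightAdj φ (b ⇨ t) ∈ S := hU (h ht)
  simpa using h1 ⊤

theorem localicPreimage_gen (φ : FrameHom X Y) (u v : X) :
    localicPreimage φ (closedSub u ⊔ openSub v) = closedSub (φ u) ⊔ openSub (φ v) := by
  refine eq_of_forall_le_iff fun T => ?_
  rw [← (gc_localicImage φ).le_iff_le, le_closedSub_sup_openSub, le_closedSub_sup_openSub]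
  change (∀ s ∈ rightAdj φ '' (T : Set Y), _) ↔ _
  rw [Set.forall_mem_image]
  simp only [← (gc_rightAdj φ).le_iff_le]
  rfl

theorem localicPreimage_closedSub (φ : FrameHom X Y) (u : X) :
    localicPreimage φ (closedSub u) = closedSub (φ u) := by
  have h := localicPreimage_gen φ u ⊥
  rwa [map_bot, openSub_bot, openSub_bot, sup_bot_eq, sup_bot_eq] at h

theorem localicPreimage_sup (φ : FrameHom X Y) (S T : Sublocale X) :
    localicPreimage φ (S ⊔ T) = localicPreimage φ S ⊔ localicPreimage φ T := by
  refine le_antisymm ?_ ((gc_localicImage φ).monotone_u.le_map_sup S T)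
  conv_rhs => rw [eq_sInf S, eq_sInf T, (gc_localicImage φ).u_sInf, (gc_localicImage φ).u_sInf,
    iInf₂_sup_eq]
  refine le_iInf₂ ?_
  rintro _ ⟨u, v, rfl, hS⟩
  rw [sup_iInf₂_eq]
  refine le_iInf₂ ?_
  rintro _ ⟨u', v', rfl, hT⟩
  rw [localicPreimage_gen, localicPreimage_gen, sup_sup_sup_comm, closedSub_sup, openSub_sup,
    ← map_inf, ← map_sup, ← localicPreimage_gen, ← closedSub_sup, ← openSub_sup,
    sup_sup_sup_comm]
  exact (gc_localicImage φ).monotone_u (sup_le_sup hS hT)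

/-- Localic preimage, as a coframe morphism `Sℓ(X) → Sℓ(Y)`. -/
def localicPreimageHom (φ : FrameHom X Y) : CoframeHom (Sublocale X) (Sublocale Y) where
  toFun := localicPreimage φ
  map_sInf' s := by rw [(gc_localicImage φ).u_sInf, sInf_image]
  map_sup' := localicPreimage_sup φ
  map_bot' := by
    rw [← closedSub_top, ← closedSub_top, localicPreimage_closedSub, map_top]

theorem localicPreimage_id (S : Sublocale X) : localicPreimage (FrameHom.id X) S = S := by
  refine eq_of_forall_le_iff fun T => ?_
  rw [← (gc_localicImage _).le_iff_le, localicImage_le_iff]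
  have h : ∀ t, rightAdj (FrameHom.id X) t = t := fun t =>
    eq_of_forall_le_iff fun c => ((gc_rightAdj (FrameHom.id X)) c t).symm
  simp only [h]
  rfl

theorem localicPreimage_comp (φ : FrameHom X Y) (ψ : FrameHom Y Z) (S : Sublocale X) :
    localicPreimage (ψ.comp φ) S = localicPreimage ψ (localicPreimage φ S) := by
  refine eq_of_forall_le_iff fun T => ?_
  rw [← (gc_localicImage _).le_iff_le, ← (gc_localicImage _).le_iff_le,
    ← (gc_localicImage _).le_iff_le, localicImage_le_iff, localicImage_le_iff]
  have h : ∀ t, rightAdj (ψ.comp φ) t = rightAdj φ (rightAdj ψ t) := fun t =>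
    eq_of_forall_le_iff fun c => by
      rw [← (gc_rightAdj _).le_iff_le, ← (gc_rightAdj _).le_iff_le, ← (gc_rightAdj _).le_iff_le]
      rfl
  simp only [h]
  change _ ↔ ∀ s ∈ rightAdj ψ '' (T : Set Z), _
  rw [Set.forall_mem_image]
  rfl

end Maps

end Sublocale

namespace TopCoFrm

/-- The topological coframe `Sℓ(Ω)` of sublocales of a frame `Ω`, ordered by inclusion, with the
closed sublocales `𝔠(u)` as its closed elements. -/
def ofFrm (Ω : Frm.{u}) : TopCoFrm.{u} where
  carrier := Sublocale Ω
  closed := Set.range Sublocale.closedSub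
  bot_mem := ⟨⊤, Sublocale.closedSub_top⟩
  top_mem := ⟨⊥, Sublocale.closedSub_bot⟩
  sup_mem := by
    rintro _ ⟨u, rfl⟩ _ ⟨v, rfl⟩
    exact ⟨u ⊓ v, (Sublocale.closedSub_sup u v).symm⟩
  inf_mem := by
    rintro _ ⟨u, rfl⟩ _ ⟨v, rfl⟩
    refine ⟨sSup {u, v}, ?_⟩
    rw [← Sublocale.sInf_image_closedSub, Set.image_pair, sInf_pair]
  isComplemented := by
    rintro _ ⟨u, rfl⟩
    exact ⟨_, Sublocale.isCompl_closedSub_openSub u⟩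

/-- The closed sublocale `𝔠(u)`, as an element of the topological coframe `Sℓ(Ω)`. -/
def cl (Ω : Frm.{u}) (u : Ω) : ofFrm Ω := Sublocale.closedSub u

theorem isStrong_ofFrm (Ω : Frm.{u}) : isStrong (ofFrm Ω) := by
  intro (s : Set (Sublocale Ω)) hs
  have h : Sublocale.closedSub '' (Sublocale.closedSub ⁻¹' s) = s :=
    Set.image_preimage_eq_of_subset hs
  exact ⟨sSup (Sublocale.closedSub ⁻¹' s), by rw [← Sublocale.sInf_image_closedSub, h]; rfl⟩

/-- The functor `Sℓ` from frames to topological coframes; it acts on morphisms by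
localic preimage. -/
def sublocales : Frm.{u} ⥤ TopCoFrm.{u} where
  obj Ω := ofFrm Ω
  map {Ω Ω'} φ := Hom.mk (L := ofFrm Ω) (L' := ofFrm Ω') (Sublocale.localicPreimageHom φ.hom) (by
    rintro _ ⟨u, rfl⟩
    exact ⟨φ.hom u, (Sublocale.localicPreimage_closedSub φ.hom u).symm⟩)
  map_id Ω := Hom.ext (CoframeHom.ext Sublocale.localicPreimage_id)
  map_comp φ ψ := Hom.ext (CoframeHom.ext (Sublocale.localicPreimage_comp φ.hom ψ.hom))

end TopCoFrm

/-- The functor `Sℓ` from frames to strong topological coframes. -/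
def Sl : Frm.{u} ⥤ StrongTopCoFrm.{u} :=
  TopCoFrm.isStrong.lift TopCoFrm.sublocales fun Ω => TopCoFrm.isStrong_ofFrm Ω

/-- The functor `⋀ C^op` restricted to strong topological coframes. -/
def wedgeCOp : StrongTopCoFrm.{u} ⥤ Frm.{u} :=
  TopCoFrm.isStrong.ι ⋙ TopCoFrm.infClosedOp

/-- `Sℓ`, as a functor from the category of locales to the opposite of the category of strong
topological coframes. -/
def SlLocale : Locale.{u} ⥤ StrongTopCoFrm.{u}ᵒᵖ := Sl.op

/-- `⋀ C^op`, as a functor from the opposite of the category of strong topological coframes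
to the category of locales. -/
def wedgeCLocale : StrongTopCoFrm.{u}ᵒᵖ ⥤ Locale.{u} := wedgeCOp.op

/-! ### Closed sublocales as generators -/

namespace Sublocale

variable {X : Type*} [Order.Frame X]

/-! The coframe `Sℓ(X)` is freely generated by adjoining complements to the closed sublocales, and
both halves of this universal property rest on `eq_sInf`: every sublocale is an intersection of
sublocales `𝔠(u) ⊔ 𝔬(v)`.

Uniqueness (`coframeHom_ext`): `𝔬(v)` is the complement of `𝔠(v)`, and coframe morphisms preserve
complements, so the values on closed sublocales force all others.

Existence (`extension`): let `φ : X → Mᵒᵈ` be a frame morphism with complemented values. The localic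
preimage of `𝔠(u) ⊔ 𝔬(v)` is `𝔠(φ u) ⊔ 𝔬(φ v)`, and `𝔬(φ v)` is the closed sublocale of the
complement of `φ v`. Closed sublocales are stable under intersection, so every localic preimage
along `φ` is closed. As `𝔠` embeds `M` into `Sℓ(Mᵒᵈ)`, preserving infima and finite suprema, localic
preimage factors through `M`; this factorization is the extension.

For `L` strong, the elements of `⋀ C(L)` are closed, hence complemented in `L`; extending the
inclusion `(⋀ C(L))ᵒᵈ → Lᵒᵈ` gives the counit. The unit is invertible because `Sℓ(Ω)` is strong and
`𝔠` is an order-reversing embedding. Naturality and the triangle identities are then checked on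
closed sublocales only. -/

theorem closedSub_le_closedSub {u v : X} : closedSub u ≤ closedSub v ↔ v ≤ u :=
  ⟨fun h => h (mem_closedSub.2 le_rfl), fun h _ hx => h.trans hx⟩

theorem closedSub_injective : Function.Injective (closedSub : X → Sublocale X) := fun _ _ h =>
  le_antisymm (closedSub_le_closedSub.1 h.ge) (closedSub_le_closedSub.1 h.le)

/-- A coframe morphism on `Sℓ(X)` is determined by its values on the closed sublocales. -/
theorem coframeHom_ext {M : Type*} [Order.Coframe M] {ψ χ : CoframeHom (Sublocale X) M}
    (h : ∀ u, ψ (closedSub u) = χ (closedSub u)) : ψ = χ := by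
  -- Binary meets and `⊤` are infima of a pair and of the empty set, so `ξ` preserves complements.
  have hcompl : ∀ (ξ : CoframeHom (Sublocale X) M) (u : X),
      IsCompl (ξ (closedSub u)) (ξ (openSub u)) := fun ξ u => by
    have hc := isCompl_closedSub_openSub u
    refine IsCompl.of_eq ?_ ?_
    · rw [← sInf_pair, ← Set.image_pair, ← ξ.apply_sInf, sInf_pair, hc.inf_eq_bot, ξ.apply_bot]
    · rw [← ξ.apply_sup, hc.sup_eq_top, ← sInf_empty, ξ.apply_sInf, Set.image_empty, sInf_empty]
  -- Complements are unique in a distributive lattice.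
  have hopen : ∀ v, ψ (openSub v) = χ (openSub v) := fun v =>
    (hcompl ψ v).right_unique (h v ▸ hcompl χ v)
  refine CoframeHom.ext fun S => ?_
  rw [eq_sInf S, ψ.apply_sInf, χ.apply_sInf]
  congr 1
  refine Set.image_congr ?_
  rintro _ ⟨u, v, rfl, -⟩
  rw [ψ.apply_sup, χ.apply_sup, h, hopen]

/-- The open sublocale of a complemented element is closed. -/
theorem openSub_eq_closedSub {a b : X} (h : IsCompl a b) : openSub a = closedSub b := by
  -- It suffices that `𝔠(b)` is also a complement of `𝔠(a)`: `𝔠` turns joins into meets and meets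
  -- into joins.
  refine (isCompl_closedSub_openSub a).right_unique (IsCompl.of_eq ?_ ?_)
  · rw [← sInf_pair, ← Set.image_pair, sInf_image_closedSub, sSup_pair, h.sup_eq_top,
      closedSub_top]
  · rw [closedSub_sup, h.inf_eq_bot, closedSub_bot]

/-- If a frame morphism takes complemented values, its localic preimages are closed. -/
theorem localicPreimage_mem_range_closedSub {Y : Type*} [Order.Frame Y] {φ : FrameHom X Y}
    (hφ : ∀ u, IsComplemented (φ u)) (S : Sublocale X) :
    localicPreimage φ S ∈ Set.range (closedSub : Y → Sublocale Y) := by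
  -- With `b` the complement of `φ v`, the preimage of a generator is `𝔠(φ u) ⊔ 𝔠(b) = 𝔠(φ u ⊓ b)`.
  have hgen : ∀ T ∈ localicPreimage φ '' {T | ∃ u v, T = closedSub u ⊔ openSub v ∧ S ≤ T},
      T ∈ Set.range (closedSub : Y → Sublocale Y) := by
    rintro _ ⟨_, ⟨u, v, rfl, -⟩, rfl⟩
    obtain ⟨b, hb⟩ := hφ v
    rw [localicPreimage_gen, openSub_eq_closedSub hb, closedSub_sup]
    exact ⟨_, rfl⟩
  have hS : localicPreimage φ S =
      sInf (localicPreimage φ '' {T | ∃ u v, T = closedSub u ⊔ openSub v ∧ S ≤ T}) := by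
    conv_lhs => rw [eq_sInf S]
    exact (localicPreimageHom φ).apply_sInf _
  rw [hS, ← Set.image_preimage_eq_of_subset hgen, sInf_image_closedSub]
  exact ⟨_, rfl⟩

/-! ### Extending frame morphisms with complemented values -/

section Extension

variable {M : Type*} [Order.Coframe M] (φ : FrameHom X Mᵒᵈ) (hφ : ∀ u, IsComplemented (φ u))

/-- The element of `M` whose closed sublocale in `Mᵒᵈ` is the localic preimage of `S`. -/
noncomputable def extensionFun (S : Sublocale X) : M :=
  OrderDual.ofDual (localicPreimage_mem_range_closedSub hφ S).choose

theorem closedSub_extensionFun (S : Sublocale X) :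
    closedSub (OrderDual.toDual (extensionFun φ hφ S)) = localicPreimage φ S :=
  (localicPreimage_mem_range_closedSub hφ S).choose_spec

/-- By injectivity of `𝔠`, equations in `M` can be tested in `Sℓ(Mᵒᵈ)`, where the axioms of a
coframe morphism are already known for localic preimage. -/
theorem extensionFun_eq_iff {S : Sublocale X} {a : M} :
    extensionFun φ hφ S = a ↔ localicPreimage φ S = closedSub (OrderDual.toDual a) := by
  rw [← closedSub_extensionFun φ hφ, closedSub_injective.eq_iff, OrderDual.toDual_inj]

/-- A frame morphism `X → Mᵒᵈ` with complemented values extends along `𝔠` to a coframe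
morphism `Sℓ(X) → M`. -/
noncomputable def extension : CoframeHom (Sublocale X) M where
  toFun := extensionFun φ hφ
  map_sInf' s := by
    rw [extensionFun_eq_iff]
    change localicPreimageHom φ (sInf s) = _
    rw [CoframeHom.apply_sInf]
    -- Infima of `M` are suprema of `Mᵒᵈ`, which `𝔠` turns back into infima of sublocales.
    have h : OrderDual.toDual (sInf (extensionFun φ hφ '' s)) =
        sSup ((fun S => OrderDual.toDual (extensionFun φ hφ S)) '' s) := by
      rw [sInf_image, sSup_image, toDual_iInf]
      simp only [toDual_iInf]
    rw [h, ← sInf_image_closedSub, Set.image_image]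
    simp only [closedSub_extensionFun]
    rfl
  map_sup' S T := by
    rw [extensionFun_eq_iff, localicPreimage_sup, toDual_sup, ← closedSub_sup,
      closedSub_extensionFun, closedSub_extensionFun]
  map_bot' := by
    rw [extensionFun_eq_iff]
    exact (localicPreimageHom φ).apply_bot.trans closedSub_top.symm

theorem extension_closedSub (u : X) :
    extension φ hφ (closedSub u) = OrderDual.ofDual (φ u) :=
  (extensionFun_eq_iff φ hφ).2 (localicPreimage_closedSub φ u)

end Extension

end Sublocale

/-! ### Counit and unit -/

namespace TopCoFrm

/-- In a strong topological coframe, every infimum of closed elements is closed. -/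
theorem infClosed_subset {L : TopCoFrm.{u}} (hL : isStrong L) : L.infClosed ⊆ L.closed := by
  rintro _ ⟨s, hs, rfl⟩
  exact hL s hs

theorem subset_infClosed (L : TopCoFrm.{u}) : L.closed ⊆ L.infClosed := fun c hc =>
  ⟨{c}, by simpa using hc, by simp⟩

/-- The inclusion of `⋀ C(L)` into `L`, as a frame morphism between the opposites. -/
def infClosedInclusion (L : TopCoFrm.{u}) : FrameHom (L.infClosed)ᵒᵈ (L : Type u)ᵒᵈ where
  toFun x := OrderDual.toDual (OrderDual.ofDual x).1
  map_inf' _ _ := rfl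
  map_top' := rfl
  map_sSup' s := by
    change sInf (Subtype.val '' (OrderDual.toDual ⁻¹' s)) = sInf _
    congr 1

/-- Strength puts `x` in `C(L)`, whose elements have complements in `L`. These need not lie in `⋀
C(L)`, which is why the inclusion is taken with values in all of `Lᵒᵈ`. -/
theorem isComplemented_infClosedInclusion {L : TopCoFrm.{u}} (hL : isStrong L)
    (x : (L.infClosed)ᵒᵈ) : IsComplemented (L.infClosedInclusion x) := by
  obtain ⟨b, hb⟩ := L.isComplemented _ (infClosed_subset hL (OrderDual.ofDual x).2)
  exact ⟨OrderDual.toDual b, hb.dual⟩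

/-- The morphism `Sℓ(⋀ C^op(L)) → L` that maps `𝔠(c)` to `c`. -/
noncomputable def counitHom {L : TopCoFrm.{u}} (hL : isStrong L) :
    ofFrm (infClosedOp.obj L) ⟶ L :=
  Hom.mk (L := ofFrm (infClosedOp.obj L)) (L' := L)
    (Sublocale.extension L.infClosedInclusion (isComplemented_infClosedInclusion hL)) (by
      rintro _ ⟨c, rfl⟩
      -- Strength is used a second time, for continuity: the value at `𝔠(c)` is `c`, which is
      -- closed.
      exact Set.mem_of_eq_of_mem (Sublocale.extension_closedSub _ _ c)
        (infClosed_subset hL (OrderDual.ofDual (α := L.infClosed) c).2))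

theorem counitHom_cl {L : TopCoFrm.{u}} (hL : isStrong L) (c : (L.infClosed)ᵒᵈ) :
    Hom.hom (counitHom hL) (cl (infClosedOp.obj L) c) = (OrderDual.ofDual c).1 :=
  Sublocale.extension_closedSub _ _ c

/-- The isomorphism `u ↦ 𝔠(u)` from `Ω` to `⋀ C^op(Sℓ(Ω))`. -/
noncomputable def unitOrderIso (Ω : Frm.{u}) : Ω ≃o ((ofFrm Ω).infClosed)ᵒᵈ :=
  RelIso.ofSurjective
    (OrderEmbedding.ofMapLEIff
      (fun u => OrderDual.toDual
        (⟨cl Ω u, subset_infClosed _ ⟨u, rfl⟩⟩ : (ofFrm Ω).infClosed))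
      fun _ _ => Sublocale.closedSub_le_closedSub)
    (by
      rintro ⟨x, hx⟩
      -- An intersection of closed sublocales is again some `𝔠(u)`.
      obtain ⟨u, rfl⟩ := infClosed_subset (isStrong_ofFrm Ω) hx
      exact ⟨u, rfl⟩)

/-- The isomorphism of frames `Ω ≅ ⋀ C^op(Sℓ(Ω))`. -/
noncomputable def unitIso (Ω : Frm.{u}) : Ω ≅ infClosedOp.obj (ofFrm Ω) :=
  Frm.Iso.mk (unitOrderIso Ω)

theorem unitIso_hom_apply (Ω : Frm.{u}) (u : Ω) :
    (OrderDual.ofDual ((unitIso Ω).hom.hom u : ((ofFrm Ω).infClosed)ᵒᵈ)).1 = cl Ω u := rfl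

/-- Morphisms out of `Sℓ(Ω)` that agree on the closed sublocales are equal. -/
theorem hom_ext_of_cl {Ω : Frm.{u}} {L : TopCoFrm.{u}} {φ ψ : ofFrm Ω ⟶ L}
    (h : ∀ u, Hom.hom φ (cl Ω u) = Hom.hom ψ (cl Ω u)) : φ = ψ :=
  Hom.ext (Sublocale.coframeHom_ext h)

theorem sublocales_map_cl {Ω Ω' : Frm.{u}} (φ : Ω ⟶ Ω') (u : Ω) :
    Hom.hom (sublocales.map φ) (cl Ω u) = cl Ω' (φ.hom u) :=
  Sublocale.localicPreimage_closedSub φ.hom u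

end TopCoFrm

/-! ### The coreflection -/

/-- The adjunction `Sℓ ⊣ ⋀ C^op`. -/
noncomputable def slAdjunction : Sl.{u} ⊣ wedgeCOp.{u} :=
  Adjunction.mkOfUnitCounit {
    unit := {
      app := fun Ω => (TopCoFrm.unitIso Ω).hom
      naturality := fun Ω Ω' φ => by
        ext u
        exact Subtype.ext (TopCoFrm.sublocales_map_cl φ u).symm }
    counit := {
      app := fun L => ObjectProperty.homMk (TopCoFrm.counitHom L.property)
      naturality := fun L L' φ => by
        -- Both composites start at a coframe of sublocales, so closed sublocales suffice; both send
        -- `𝔠(c)` to the value of `φ` at `c`.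
        refine ObjectProperty.hom_ext _ (TopCoFrm.hom_ext_of_cl fun c => ?_)
        change TopCoFrm.Hom.hom (TopCoFrm.counitHom L'.property)
            (TopCoFrm.Hom.hom (TopCoFrm.sublocales.map (wedgeCOp.map φ))
              (TopCoFrm.cl (wedgeCOp.obj L) c)) =
          TopCoFrm.Hom.hom φ.hom (TopCoFrm.Hom.hom (TopCoFrm.counitHom L.property)
            (TopCoFrm.cl (wedgeCOp.obj L) c))
        rw [TopCoFrm.sublocales_map_cl]
        refine (TopCoFrm.counitHom_cl L'.property _).trans ?_
        exact congrArg _ (TopCoFrm.counitHom_cl L.property c).symm }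
    left_triangle := by
      ext Ω : 2
      refine ObjectProperty.hom_ext _ (TopCoFrm.hom_ext_of_cl fun c => ?_)
      change TopCoFrm.Hom.hom (TopCoFrm.counitHom (TopCoFrm.isStrong_ofFrm Ω))
          (TopCoFrm.Hom.hom (TopCoFrm.sublocales.map (TopCoFrm.unitIso Ω).hom) (TopCoFrm.cl Ω c)) =
        TopCoFrm.cl Ω c
      rw [TopCoFrm.sublocales_map_cl]
      exact TopCoFrm.counitHom_cl _ _
    right_triangle := by
      ext L c
      exact Subtype.ext (TopCoFrm.counitHom_cl L.property c) }

theorem mainTheorem12 :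
    -- `Sℓ(φ)` is the unique coframe morphism that maps `𝔠(u)` to `𝔠(φ(u))` for every `u`
    (∀ (Ω Ω' : Frm.{u}) (φ : Ω ⟶ Ω'),
      (∀ u : Ω, TopCoFrm.Hom.hom (Sl.map φ).hom (TopCoFrm.cl Ω u) = TopCoFrm.cl Ω' (φ.hom u)) ∧
      ∀ ψ : CoframeHom (Sl.obj Ω).obj (Sl.obj Ω').obj,
        (∀ u : Ω, ψ (TopCoFrm.cl Ω u) = TopCoFrm.cl Ω' (φ.hom u)) →
          ψ = TopCoFrm.Hom.hom (Sl.map φ).hom) ∧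
    -- `Sℓ ⊣ ⋀ C^op` is a coreflection, with unit `u ↦ 𝔠(u)` and counit `𝔠(c) ↦ c`
    (Sl.{u}.Full ∧ Sl.{u}.Faithful ∧ ∃ adj : Sl.{u} ⊣ wedgeCOp.{u}, IsIso adj.unit ∧
      (∀ (Ω : Frm.{u}) (u : Ω),
        (OrderDual.ofDual ((adj.unit.app Ω).hom u : (TopCoFrm.infClosed (Sl.obj Ω).obj)ᵒᵈ)).1 =
          TopCoFrm.cl Ω u) ∧
      (∀ (L : StrongTopCoFrm.{u}) (c : (TopCoFrm.infClosed L.obj)ᵒᵈ),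
        TopCoFrm.Hom.hom (adj.counit.app L).hom (TopCoFrm.cl (wedgeCOp.obj L) c) =
          (OrderDual.ofDual c).1)) ∧
    -- locales form a reflective subcategory of the opposite of strong topological coframes
    (∃ r : Reflective SlLocale.{u}, r.L = wedgeCLocale.{u}) := by
  have hiso : IsIso slAdjunction.{u}.unit :=
    have (Ω : Frm.{u}) : IsIso (slAdjunction.unit.app Ω) := (TopCoFrm.unitIso Ω).isIso_hom
    NatIso.isIso_of_isIso_app _
  -- A left adjoint whose unit is invertible is fully faithful.
  have hff := slAdjunction.{u}.fullyFaithfulLOfIsIsoUnit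
  have hfull := hff.full
  have hfaithful := hff.faithful
  refine ⟨fun Ω Ω' φ => ⟨TopCoFrm.sublocales_map_cl φ, fun ψ h => ?_⟩,
    ⟨hfull, hfaithful, slAdjunction, hiso, TopCoFrm.unitIso_hom_apply,
      fun L c => TopCoFrm.counitHom_cl L.property c⟩, ?_⟩
  · exact Sublocale.coframeHom_ext fun u => (h u).trans (TopCoFrm.sublocales_map_cl φ u).symm
  · have : SlLocale.{u}.Full := inferInstanceAs Sl.{u}.op.Full
    have : SlLocale.{u}.Faithful := inferInstanceAs Sl.{u}.op.Faithful
    -- Passing to opposite categories exchanges left and right adjoints, so the coreflection becomes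
    -- a reflection.
    exact ⟨{ L := wedgeCLocale, adj := slAdjunction.op }, rfl⟩
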